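/- Let $\mathrm{Homeo}_+(\mathbb{R})$ be the group of orientation-preserving homeomorphisms of $\mathbb{R}$. The support of a homeomorphism is the set of points it moves (no closure is taken), and the support of a group of homeomorphisms is the union of the supports of its elements. For a subgroup $E\le\mathrm{Homeo}_+(\mathbb{R})$ and real numbers $a<b$ put \[ E[a,b]=\{f\in E \mid f \text{ has support contained in } [a,b]\}. \] Call $E$ locally moving if for all $a<b$ in $\mathbb{R}$ the group $E[a,b]$ has no global fixed point in $(a,b)$. Say that $E$ has abelian germs if for every $x\in\mathbb{R}$ the group of germs of $E$ at $x$ is abelian; this group is the quotient of the stabilizer of $x$ in $E$ by the normal subgroup of all elements that fix every point of some open neighborhood of $x$. Let $V$ be Thompson's group $V$, that is, the group of all homeomorphisms $h$ of Cantor space $\mathfrak{C}=\{0,1\}^{\mathbb{N}}$ such that every $\kappa\in\mathfrak{C}$ has a finite prefix $w$ for which there is a finite word $u$ with $h(w\kappa')=u\kappa'$ for all $\kappa'\in\mathfrak{C}$. **Proposition.** Let $E\le\mathrm{Homeo}_+(\mathbb{R})$ be locally moving with abelian germs, and let $\iota\colon E\to V$ be an injective group homomorphism. For $a<b$ in $\mathbb{R}$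 let $G[a,b]=\iota(E[a,b])$, and let $G[a,b]'$ be its commutator subgroup. If $a<b$ and $c<d$ are real numbers with $(a,b)\cap(c,d)=\emptyset$, then $G[a,b]'$ and $G[c,d]'$ have disjoint supports in $\mathfrak{C}$. -/

import Mathlib

namespace ThompsonAction

/-! ## Supports -/

/-- The support of a homeomorphism: the set of points that it moves (no closure is taken). -/
def supp {X : Type*} [TopologicalSpace X] (f : X ≃ₜ X) : Set X := {x | f x ≠ x}

/-- The support of a group of homeomorphisms: the set of points that some element moves. -/
def groupSupp {X : Type*} [TopologicalSpace X] (H : Subgroup (X ≃ₜ X)) : Set X :=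
  ⋃ f ∈ H, supp f

/-! ## Groups of homeomorphisms of the line -/

/-- The group of orientation-preserving homeomorphisms of the real line. -/
def homeoPlus : Subgroup (ℝ ≃ₜ ℝ) where
  carrier := {f | StrictMono f}
  mul_mem' := fun {_ _} hf hg _ _ h => hf (hg h)
  one_mem' := fun _ _ h => h
  inv_mem' := fun {f} hf x y h => by
    have h' : StrictMono f := hf
    rw [← h'.lt_iff_lt]
    simpa using h

/-- The subgroup `E[a,b]` of `E` of all elements with support contained in `[a,b]`. -/
def rigid (E : Subgroup (ℝ ≃ₜ ℝ)) (a b : ℝ) : Subgroup E where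
  carrier := {f | supp (f : ℝ ≃ₜ ℝ) ⊆ Set.Icc a b}
  mul_mem' := fun {f g} hf hg x hx => by
    by_contra hn
    have h1 : (g : ℝ ≃ₜ ℝ) x = x := by
      by_contra h
      exact hn (hg h)
    have h2 : (f : ℝ ≃ₜ ℝ) x = x := by
      by_contra h
      exact hn (hf h)
    exact hx (by simp [h1, h2])
  one_mem' := fun x hx => absurd rfl hx
  inv_mem' := fun {f} hf x hx => hf fun h => hx (by
    have h' : (f : ℝ ≃ₜ ℝ) x = x := h
    change (f : ℝ ≃ₜ ℝ).symm x = x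
    rw [Homeomorph.symm_apply_eq]
    exact h'.symm)

/-- `E` is locally moving: for all `a < b` the group `E[a,b]` has no global fixed point
in the open interval `(a,b)`. -/
def LocallyMoving (E : Subgroup (ℝ ≃ₜ ℝ)) : Prop :=
  ∀ a b : ℝ, a < b → ¬ ∃ x ∈ Set.Ioo a b, ∀ f ∈ rigid E a b, (f : ℝ ≃ₜ ℝ) x = x

/-! ## Germs -/

/-- The stabilizer of the point `x` in `E`. -/
def stab (E : Subgroup (ℝ ≃ₜ ℝ)) (x : ℝ) : Subgroup E where
  carrier := {f | (f : ℝ ≃ₜ ℝ) x = x}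
  mul_mem' := fun {f g} hf hg => by
    change (f : ℝ ≃ₜ ℝ) ((g : ℝ ≃ₜ ℝ) x) = x
    rw [show (g : ℝ ≃ₜ ℝ) x = x from hg]
    exact hf
  one_mem' := rfl
  inv_mem' := fun {f} hf => by
    change (f : ℝ ≃ₜ ℝ).symm x = x
    rw [Homeomorph.symm_apply_eq]
    exact (show (f : ℝ ≃ₜ ℝ) x = x from hf).symm

/-- The subgroup of `stab E x` of all elements that fix every point of some open neighborhood
of `x`. -/
def trivialGerm (E : Subgroup (ℝ ≃ₜ ℝ)) (x : ℝ) : Subgroup (stab E x) where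
  carrier := {f | ∃ U : Set ℝ, IsOpen U ∧ x ∈ U ∧ ∀ y ∈ U, ((f : E) : ℝ ≃ₜ ℝ) y = y}
  mul_mem' := by
    rintro f g ⟨U, hU, hxU, hf⟩ ⟨W, hW, hxW, hg⟩
    refine ⟨U ∩ W, hU.inter hW, ⟨hxU, hxW⟩, fun y hy => ?_⟩
    change ((f : E) : ℝ ≃ₜ ℝ) (((g : E) : ℝ ≃ₜ ℝ) y) = y
    rw [hg y hy.2, hf y hy.1]
  one_mem' := ⟨Set.univ, isOpen_univ, trivial, fun _ _ => rfl⟩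
  inv_mem' := by
    rintro f ⟨U, hU, hxU, hf⟩
    refine ⟨U, hU, hxU, fun y hy => ?_⟩
    change ((f : E) : ℝ ≃ₜ ℝ).symm y = y
    rw [Homeomorph.symm_apply_eq]
    exact (hf y hy).symm

instance trivialGerm_normal (E : Subgroup (ℝ ≃ₜ ℝ)) (x : ℝ) : (trivialGerm E x).Normal where
  conj_mem := by
    rintro f ⟨U, hU, hxU, hf⟩ g
    have hgx : ((g : E) : ℝ ≃ₜ ℝ).symm x = x := by
      rw [Homeomorph.symm_apply_eq]
      exact (show ((g : E) : ℝ ≃ₜ ℝ) x = x from g.2).symm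
    refine ⟨((g : E) : ℝ ≃ₜ ℝ).symm ⁻¹' U, hU.preimage (Homeomorph.continuous _),
      by rw [Set.mem_preimage, hgx]; exact hxU, fun y hy => ?_⟩
    change ((g : E) : ℝ ≃ₜ ℝ) (((f : E) : ℝ ≃ₜ ℝ) (((g : E) : ℝ ≃ₜ ℝ).symm y)) = y
    rw [hf _ hy, Homeomorph.apply_symm_apply]

/-- The group of germs of `E` at `x`. -/
abbrev GermGroup (E : Subgroup (ℝ ≃ₜ ℝ)) (x : ℝ) : Type := stab E x ⧸ trivialGerm E x

/-- `E` has abelian germs: its group of germs at every real point is abelian. -/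
def HasAbelianGerms (E : Subgroup (ℝ ≃ₜ ℝ)) : Prop :=
  ∀ x : ℝ, ∀ g h : GermGroup E x, g * h = h * g

/-! ## Thompson's group `V` -/

/-- Cantor space: infinite binary sequences, with the product topology. -/
abbrev Cantor : Type := ℕ → Bool

/-- The infinite sequence `wκ` obtained by putting the finite word `w` in front of `κ`. -/
def prepend : List Bool → Cantor → Cantor
  | [], κ => κ
  | e :: w, κ => fun n => Nat.casesOn n e (prepend w κ)

theorem prepend_append (v w : List Bool) (κ : Cantor) :
    prepend (v ++ w) κ = prepend v (prepend w κ) := by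
  induction v with
  | nil => rfl
  | cons e v ih => simp only [List.cons_append, prepend, ih]

theorem prepend_cons_inj {d e : Bool} {v w : List Bool} {κ μ : Cantor}
    (h : prepend (d :: v) κ = prepend (e :: w) μ) : d = e ∧ prepend v κ = prepend w μ :=
  ⟨congrFun h 0, funext fun n => congrFun h (n + 1)⟩

/-- Two finite prefixes of one sequence are comparable. -/
theorem prepend_compare (u v : List Bool) (κ μ : Cantor) (h : prepend u κ = prepend v μ) :
    (∃ s, u = v ++ s ∧ μ = prepend s κ) ∨ (∃ s, v = u ++ s ∧ κ = prepend s μ) := by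
  induction u generalizing v with
  | nil => exact Or.inr ⟨v, rfl, h⟩
  | cons d u ih =>
    cases v with
    | nil => exact Or.inl ⟨d :: u, rfl, h.symm⟩
    | cons e v =>
      obtain ⟨rfl, h'⟩ := prepend_cons_inj h
      rcases ih v h' with ⟨s, rfl, hs⟩ | ⟨s, rfl, hs⟩
      · exact Or.inl ⟨s, rfl, hs⟩
      · exact Or.inr ⟨s, rfl, hs⟩

/-- Thompson's group `V`: the homeomorphisms `h` of Cantor space such that every point `κ` has a
finite prefix `w` for which there is a finite word `u` with `h (wκ') = uκ'` for all `κ'`. -/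
def thompsonV : Subgroup (Cantor ≃ₜ Cantor) where
  carrier := {h | ∀ κ : Cantor, ∃ w u : List Bool,
    (∃ μ, κ = prepend w μ) ∧ ∀ κ', h (prepend w κ') = prepend u κ'}
  mul_mem' := by
    intro h g hh hg κ
    obtain ⟨w, u, ⟨μ, rfl⟩, hwu⟩ := hg κ
    obtain ⟨v, t, ⟨ν, hν⟩, hvt⟩ := hh (g (prepend w μ))
    rw [hwu] at hν
    rcases prepend_compare u v μ ν hν with ⟨s, rfl, hs⟩ | ⟨s, rfl, hs⟩
    · refine ⟨w, t ++ s, ⟨μ, rfl⟩, fun κ' => ?_⟩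
      rw [Homeomorph.mul_apply, hwu, prepend_append, hvt, prepend_append]
    · refine ⟨w ++ s, t, ⟨ν, by rw [prepend_append, hs]⟩, fun κ' => ?_⟩
      rw [Homeomorph.mul_apply, prepend_append, hwu, ← prepend_append, hvt]
  one_mem' := fun κ => ⟨[], [], ⟨κ, rfl⟩, fun _ => rfl⟩
  inv_mem' := by
    intro h hh κ
    obtain ⟨w, u, ⟨μ, hμ⟩, hwu⟩ := hh (h.symm κ)
    refine ⟨u, w, ⟨μ, ?_⟩, fun κ' => ?_⟩
    · rw [← hwu, ← hμ, Homeomorph.apply_symm_apply]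
    · change h.symm (prepend u κ') = prepend w κ'
      rw [Homeomorph.symm_apply_eq, hwu]

/-! ## The images of the groups `E[a,b]` in `V` -/

/-- For a homomorphism `ι : E → V`, the group `G[a,b]`, the image of `E[a,b]` under `ι`, as a
group of homeomorphisms of Cantor space. -/
def imageRigid {E : Subgroup (ℝ ≃ₜ ℝ)} (ι : E →* thompsonV) (a b : ℝ) :
    Subgroup (Cantor ≃ₜ Cantor) :=
  (rigid E a b).map (thompsonV.subtype.comp ι)

/-- The commutator subgroup `G[a,b]'` of `G[a,b]`. -/
def imageRigidDerived {E : Subgroup (ℝ ≃ₜ ℝ)} (ι : E →* thompsonV) (a b : ℝ) :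
    Subgroup (Cantor ≃ₜ Cantor) :=
  ⁅imageRigid ι a b, imageRigid ι a b⁆

end ThompsonAction

namespace ThompsonAction

open scoped commutatorElement

/-! ## Elements of the groups `E[a,b]` -/

/-! Write A = E[a,b] and B = E[c,d]; disjointness of the intervals makes A and B commute. Two
independent facts combine.

On the line, every nontrivial subgroup of A normalized by A contains A' (`commutator_rigid_le`):
local movement gives this for commutators of elements supported away from the endpoints, and abelian
germs carry it to all of A'.

In V, each element α splits Cantor space into points near which some power of α is trivial and
points attracted, under a positive or negative power of α, to one of finitely many hyperbolic
periodic points (`torsion_or_inBasin`, `finite_hyperbolicPoints`). One power of α is trivial on the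
whole torsion part (`exists_pow_fix_torsionPart`).

For f in A, the group B permutes the hyperbolic points of ι f. Germs of V at a fixed point are
detected by an integer, so commutators of suitable powers in B are trivial near all of them. By the
first fact B' is trivial near them, and commutation with ι f spreads this over the basins. Hence the
support Z of B' lies in the torsion part of every ι f, and a nontrivial power of any nontrivial f in
A fixes Z pointwise. The pointwise stabilizer of Z is normal in A, so by the first fact again it
contains A'. -/

theorem mem_rigid_iff {E : Subgroup (ℝ ≃ₜ ℝ)} {a b : ℝ} {f : E} :
    f ∈ rigid E a b ↔ ∀ x, x ∉ Set.Ioo a b → (f : ℝ ≃ₜ ℝ) x = x := by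
  constructor
  · intro hf x hx
    by_contra h
    -- The support is open, so inside [a,b] it lies in the interior (a,b).
    have ho : IsOpen (supp (f : ℝ ≃ₜ ℝ)) :=
      isOpen_ne_fun (f : ℝ ≃ₜ ℝ).continuous continuous_id
    have hs : supp (f : ℝ ≃ₜ ℝ) ⊆ Set.Icc a b := hf
    have := interior_maximal hs ho h
    rw [interior_Icc] at this
    exact hx this
  · intro hf x hx
    by_contra h
    exact hx (hf x fun h' => h (Set.Ioo_subset_Icc_self h'))

theorem rigid_mono {E : Subgroup (ℝ ≃ₜ ℝ)} {a b c d : ℝ} (hca : c ≤ a) (hbd : b ≤ d) :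
    rigid E a b ≤ rigid E c d :=
  fun _ hf => Set.Subset.trans hf (Set.Icc_subset_Icc hca hbd)

theorem coe_mul_apply {X : Type*} [TopologicalSpace X] {E : Subgroup (X ≃ₜ X)} (f g : E) (x : X) :
    ((f * g : E) : X ≃ₜ X) x = (f : X ≃ₜ X) ((g : X ≃ₜ X) x) := rfl

theorem coe_inv_apply_self {X : Type*} [TopologicalSpace X] {E : Subgroup (X ≃ₜ X)} (f : E)
    (x : X) : ((f⁻¹ : E) : X ≃ₜ X) ((f : X ≃ₜ X) x) = x := by
  rw [← coe_mul_apply, inv_mul_cancel]; rfl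

theorem coe_apply_inv_self {X : Type*} [TopologicalSpace X] {E : Subgroup (X ≃ₜ X)} (f : E)
    (x : X) : (f : X ≃ₜ X) (((f⁻¹ : E) : X ≃ₜ X) x) = x := by
  rw [← coe_mul_apply, mul_inv_cancel]; rfl

theorem coe_inv_apply_eq_iff {X : Type*} [TopologicalSpace X] {E : Subgroup (X ≃ₜ X)} (f : E)
    {x y : X} : ((f⁻¹ : E) : X ≃ₜ X) x = y ↔ x = (f : X ≃ₜ X) y := by
  constructor
  · rintro rfl; rw [coe_apply_inv_self]
  · rintro rfl; rw [coe_inv_apply_self]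

theorem ext_apply {X : Type*} [TopologicalSpace X] {E : Subgroup (X ≃ₜ X)} {f g : E}
    (h : ∀ x, (f : X ≃ₜ X) x = (g : X ≃ₜ X) x) : f = g :=
  Subtype.ext (Homeomorph.ext h)

theorem coe_pow_apply {X : Type*} [TopologicalSpace X] {E : Subgroup (X ≃ₜ X)} (f : E) (n : ℕ)
    (x : X) : ((f ^ n : E) : X ≃ₜ X) x = (f : X ≃ₜ X)^[n] x := by
  induction n with
  | zero => rfl
  | succ n ih => rw [pow_succ', coe_mul_apply, ih, Function.iterate_succ_apply']

theorem exists_apply_ne {X : Type*} [TopologicalSpace X] {E : Subgroup (X ≃ₜ X)} {f : E}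
    (hf : f ≠ 1) : ∃ x, (f : X ≃ₜ X) x ≠ x := by
  by_contra! h
  exact hf (ext_apply h)

/-- Homeomorphisms with disjoint supports commute. -/
theorem commute_of_fix {X : Type*} [TopologicalSpace X] {E : Subgroup (X ≃ₜ X)} {f g : E}
    {s t : Set X} (hst : Disjoint s t) (hf : ∀ x, x ∉ s → (f : X ≃ₜ X) x = x)
    (hg : ∀ x, x ∉ t → (g : X ≃ₜ X) x = x) : Commute f g := by
  refine ext_apply fun x => ?_
  rw [coe_mul_apply, coe_mul_apply]
  have key : ∀ {f g : E} {s t : Set X}, Disjoint s t → (∀ x, x ∉ s → (f : X ≃ₜ X) x = x) →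
      (∀ x, x ∉ t → (g : X ≃ₜ X) x = x) → x ∈ s →
      (f : X ≃ₜ X) ((g : X ≃ₜ X) x) = (g : X ≃ₜ X) ((f : X ≃ₜ X) x) := by
    intro f g s t hst hf hg hx
    have hfx : (f : X ≃ₜ X) x ∈ s := by
      by_contra h
      have := (f : X ≃ₜ X).injective (hf _ h)
      rw [this] at h
      exact h hx
    rw [hg x (hst.notMem_of_mem_left hx), hg _ (hst.notMem_of_mem_left hfx)]
  by_cases hs : x ∈ s
  · exact key hst hf hg hs
  · by_cases ht : x ∈ t
    · exact (key hst.symm hg hf ht).symm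
    · rw [hf x hs, hg x ht, hf x hs]

theorem rigid_commute {E : Subgroup (ℝ ≃ₜ ℝ)} {a b c d : ℝ}
    (h : Set.Ioo a b ∩ Set.Ioo c d = ∅) {f g : E} (hf : f ∈ rigid E a b)
    (hg : g ∈ rigid E c d) : Commute f g :=
  commute_of_fix (Set.disjoint_iff_inter_eq_empty.2 h) (mem_rigid_iff.1 hf) (mem_rigid_iff.1 hg)

section

variable {E : Subgroup (ℝ ≃ₜ ℝ)}

theorem strictMono_coe (hE : E ≤ homeoPlus) (f : E) : StrictMono (f : ℝ ≃ₜ ℝ) := hE f.2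

theorem conj_mem_rigid (hE : E ≤ homeoPlus) {a b : ℝ} {f : E} (hf : f ∈ rigid E a b) (h : E) :
    h * f * h⁻¹ ∈ rigid E ((h : ℝ ≃ₜ ℝ) a) ((h : ℝ ≃ₜ ℝ) b) := by
  rw [mem_rigid_iff] at hf ⊢
  intro x hx
  obtain ⟨y, rfl⟩ := (h : ℝ ≃ₜ ℝ).surjective x
  rw [coe_mul_apply, coe_mul_apply, coe_inv_apply_self, hf]
  rintro ⟨h1, h2⟩
  exact hx ⟨strictMono_coe hE h h1, strictMono_coe hE h h2⟩

/-- A monotone map pushes a moved point ever further in the same direction; in particular `E` is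
torsion-free. -/
theorem pow_apply_ne (hE : E ≤ homeoPlus) {f : E} {x : ℝ} (hx : (f : ℝ ≃ₜ ℝ) x ≠ x) {m : ℕ}
    (hm : 0 < m) : ((f ^ m : E) : ℝ ≃ₜ ℝ) x ≠ x := by
  rw [coe_pow_apply]
  intro h
  have := (Function.Commute.iterate_pos_eq_iff_map_eq
    (Function.Commute.id_right (f := (f : ℝ ≃ₜ ℝ))) (strictMono_coe hE f).monotone
    strictMono_id hm (x := x)).1 (by simpa using h)
  exact hx this

/-! ## Moving points and intervals -/

/-- If the orbit of `x` stayed below `y`, its supremum would be a global fixed point in (a,b). -/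
theorem exists_rigid_apply_gt (hE : E ≤ homeoPlus) (hlm : LocallyMoving E) {a b x y : ℝ}
    (hx : x ∈ Set.Ioo a b) (hy : y < b) : ∃ f ∈ rigid E a b, y < (f : ℝ ≃ₜ ℝ) x := by
  by_contra! hcon
  set O : Set ℝ := {z | ∃ f ∈ rigid E a b, (f : ℝ ≃ₜ ℝ) x = z}
  have hxO : x ∈ O := ⟨1, one_mem _, rfl⟩
  have hbd : BddAbove O := ⟨y, by rintro _ ⟨f, hf, rfl⟩; exact hcon f hf⟩
  have hxs : x ≤ sSup O := le_csSup hbd hxO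
  have hsy : sSup O ≤ y := csSup_le ⟨x, hxO⟩ (by rintro _ ⟨f, hf, rfl⟩; exact hcon f hf)
  have hle : ∀ f ∈ rigid E a b, (f : ℝ ≃ₜ ℝ) (sSup O) ≤ sSup O := by
    intro f hf
    by_contra! h
    have h1 := strictMono_coe hE f⁻¹ h
    rw [coe_inv_apply_self] at h1
    obtain ⟨_, ⟨g, hg, rfl⟩, h2⟩ := exists_lt_of_lt_csSup ⟨x, hxO⟩ h1
    have h3 := strictMono_coe hE f h2
    rw [coe_apply_inv_self] at h3
    exact h3.not_ge (le_csSup hbd ⟨f * g, mul_mem hf hg, rfl⟩)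
  refine hlm a b (hx.1.trans hx.2) ⟨sSup O, ⟨hx.1.trans_le hxs, hsy.trans_lt hy⟩, fun f hf => ?_⟩
  refine le_antisymm (hle f hf) ?_
  have := (strictMono_coe hE f).monotone (hle f⁻¹ (inv_mem hf))
  rwa [coe_apply_inv_self] at this

theorem exists_rigid_apply_lt (hE : E ≤ homeoPlus) (hlm : LocallyMoving E) {a b x y : ℝ}
    (hx : x ∈ Set.Ioo a b) (hy : a < y) : ∃ f ∈ rigid E a b, (f : ℝ ≃ₜ ℝ) x < y := by
  rcases lt_or_ge x y with hxy | hxy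
  · exact ⟨1, one_mem _, hxy⟩
  obtain ⟨z, haz, hzy⟩ := exists_between hy
  obtain ⟨f, hf, h⟩ := exists_rigid_apply_gt hE hlm (x := z) (y := x)
    ⟨haz, (hzy.trans_le hxy).trans hx.2⟩ hx.2
  refine ⟨f⁻¹, inv_mem hf, lt_trans ?_ hzy⟩
  have := strictMono_coe hE f⁻¹ h
  rwa [coe_inv_apply_self] at this

theorem exists_rigid_ne (hlm : LocallyMoving E) {a b : ℝ} (hab : a < b) :
    ∃ f ∈ rigid E a b, ∃ x ∈ Set.Ioo a b, (f : ℝ ≃ₜ ℝ) x ≠ x := by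
  obtain ⟨x, hx⟩ := exists_between hab
  by_contra! h
  exact hlm a b hab ⟨x, hx, fun f hf => h f hf x hx⟩

/-- First push `p` beyond `u`; then pull the image of `q` below `v` by an element supported to the
right of `u`, which cannot bring `p` back across `u`. Support away from `a` and `b` is needed later,
when the conjugator itself enters commutators. -/
theorem exists_rigid_move_interval (hE : E ≤ homeoPlus) (hlm : LocallyMoving E)
    {a b p q u v : ℝ} (hap : a < p) (hpq : p < q) (hqb : q < b) (hau : a < u) (huv : u < v)
    (hvb : v < b) : ∃ a' b', a < a' ∧ b' < b ∧ ∃ c ∈ rigid E a' b',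
      u < (c : ℝ ≃ₜ ℝ) p ∧ (c : ℝ ≃ₜ ℝ) q < v := by
  obtain ⟨a', ha, ha'⟩ := exists_between (lt_min hap hau)
  obtain ⟨b', hb', hb⟩ := exists_between (max_lt hqb hvb)
  rw [lt_min_iff] at ha'
  rw [max_lt_iff] at hb'
  obtain ⟨f, hf, hf'⟩ := exists_rigid_apply_gt hE hlm (x := p) (y := u) (a := a') (b := b')
    ⟨ha'.1, hpq.trans hb'.1⟩ (huv.trans hb'.2)
  have hfq : (f : ℝ ≃ₜ ℝ) q < b' := by
    have := strictMono_coe hE f hb'.1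
    rwa [mem_rigid_iff.1 hf b' (by simp)] at this
  obtain ⟨g, hg, hg'⟩ := exists_rigid_apply_lt hE hlm (x := (f : ℝ ≃ₜ ℝ) q) (y := v) (a := u)
    (b := b') ⟨hf'.trans (strictMono_coe hE f hpq), hfq⟩ huv
  refine ⟨a', b', ha, hb, g * f, mul_mem (rigid_mono ha'.2.le le_rfl hg) hf, ?_, hg'⟩
  have := strictMono_coe hE g hf'
  rwa [mem_rigid_iff.1 hg u (by simp)] at this

theorem exists_displaced_interval {f : ℝ ≃ₜ ℝ} {a b x : ℝ} (hx : x ∈ Set.Ioo a b) (hf : f x ≠ x) :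
    ∃ u v, a < u ∧ u < v ∧ v < b ∧ ∀ y ∈ Set.Ioo u v, f y ∉ Set.Ioo u v := by
  obtain ⟨U, W, hU, hW, hxU, hxW, hUW⟩ := t2_separation hf
  have hnhds : f ⁻¹' U ∩ W ∩ Set.Ioo a b ∈ nhds x :=
    ((hU.preimage f.continuous).inter hW |>.inter isOpen_Ioo).mem_nhds ⟨⟨hxU, hxW⟩, hx⟩
  obtain ⟨u, v, hxuv, hsub⟩ := mem_nhds_iff_exists_Ioo_subset.1 hnhds
  obtain ⟨u', hu, hu'⟩ := exists_between hxuv.1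
  obtain ⟨v', hv, hv'⟩ := exists_between hxuv.2
  refine ⟨u', v', (hsub ⟨hu, hu'.trans hxuv.2⟩).2.1, hu'.trans hv,
    (hsub ⟨hxuv.1.trans hv, hv'⟩).2.2, fun y hy hy' => ?_⟩
  have hsub' : Set.Ioo u' v' ⊆ Set.Ioo u v := Set.Ioo_subset_Ioo hu.le hv'.le
  exact hUW.le_bot ⟨(hsub (hsub' hy)).1.1, (hsub (hsub' hy')).1.2⟩

/-! ## Normal subgroups of `E[a,b]` -/

/-- A subgroup normalized by `E[a,b]` that moves a point of `(a,b)` contains the derived subgroups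
of all `E[p,q]` with `a < p < q < b`. -/
theorem commutator_mem_of_compact_support (hE : E ≤ homeoPlus) (hlm : LocallyMoving E) {a b : ℝ}
    {N : Subgroup E} (hN : ∀ g ∈ rigid E a b, ∀ n ∈ N, g * n * g⁻¹ ∈ N) {n : E} (hn : n ∈ N)
    {x : ℝ} (hx : x ∈ Set.Ioo a b) (hnx : (n : ℝ ≃ₜ ℝ) x ≠ x) {p q : ℝ} (hap : a < p)
    (hpq : p < q) (hqb : q < b) {f g : E} (hf : f ∈ rigid E p q) (hg : g ∈ rigid E p q) :
    ⁅f, g⁆ ∈ N := by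
  obtain ⟨u, v, hau, huv, hvb, hdis⟩ := exists_displaced_interval hx hnx
  obtain ⟨a', b', ha', hb', c, hc, hcp, hcq⟩ :=
    exists_rigid_move_interval hE hlm hap hpq hqb hau huv hvb
  have hcA : c ∈ rigid E a b := rigid_mono ha'.le hb'.le hc
  have hmem : ∀ {f : E}, f ∈ rigid E p q → c * f * c⁻¹ ∈ rigid E u v := fun hf =>
    rigid_mono hcp.le hcq.le (conj_mem_rigid hE hf c)
  have hdisj : ∀ {f g : E}, f ∈ rigid E u v → g ∈ rigid E u v → Commute (n * f * n⁻¹) g := by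
    intro f g hf hg
    refine commute_of_fix (s := (n : ℝ ≃ₜ ℝ) '' Set.Ioo u v) (t := Set.Ioo u v) ?_ ?_
      (mem_rigid_iff.1 hg)
    · rw [Set.disjoint_left]
      rintro _ ⟨y, hy, rfl⟩
      exact hdis y hy
    · intro y hy
      obtain ⟨z, rfl⟩ := (n : ℝ ≃ₜ ℝ).surjective y
      rw [coe_mul_apply, coe_mul_apply, coe_inv_apply_self, mem_rigid_iff.1 hf]
      exact fun hz => hy ⟨z, hz, rfl⟩
  -- Conjugation by `c` brings both elements into (u,v), which `n` displaces. Then n f₁⁻¹ n⁻¹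
  -- commutes with g₁, and [[f₁,n],g₁] collapses to [f₁,g₁].
  set f₁ := c * f * c⁻¹ with hf₁
  set g₁ := c * g * c⁻¹ with hg₁
  have huvA : rigid E u v ≤ rigid E a b := rigid_mono hau.le hvb.le
  have h1 : ⁅f₁, n⁆ ∈ N := by
    rw [commutatorElement_def]
    exact mul_mem (hN _ (huvA (hmem hf)) _ hn) (inv_mem hn)
  have h2 : ⁅⁅f₁, n⁆, g₁⁆ ∈ N := by
    rw [commutatorElement_def, mul_assoc, mul_assoc, ← mul_assoc g₁]
    exact mul_mem h1 (hN _ (huvA (hmem hg)) _ (inv_mem h1))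
  have h3 : ⁅⁅f₁, n⁆, g₁⁆ = ⁅f₁, g₁⁆ := by
    have hcomm : n * f₁⁻¹ * n⁻¹ * g₁ = g₁ * (n * f₁⁻¹ * n⁻¹) :=
      hdisj (inv_mem (hmem hf)) (hmem hg)
    have : ⁅⁅f₁, n⁆, g₁⁆ = f₁ * (n * f₁⁻¹ * n⁻¹ * g₁) * (n * f₁ * n⁻¹) * f₁⁻¹ * g₁⁻¹ := by
      simp only [commutatorElement_def]; group
    rw [this, hcomm]
    simp only [commutatorElement_def]; group
  rw [h3] at h2
  have h4 := hN c⁻¹ (inv_mem hcA) _ h2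
  have h5 : c⁻¹ * ⁅f₁, g₁⁆ * c⁻¹⁻¹ = ⁅f, g⁆ := by
    simp only [hf₁, hg₁, commutatorElement_def]; group
  rwa [h5] at h4

theorem exists_fix_nhds_commutator (hag : HasAbelianGerms E) {f g : E} {x : ℝ}
    (hf : (f : ℝ ≃ₜ ℝ) x = x) (hg : (g : ℝ ≃ₜ ℝ) x = x) :
    ∃ U : Set ℝ, IsOpen U ∧ x ∈ U ∧ ∀ y ∈ U, ((⁅f, g⁆ : E) : ℝ ≃ₜ ℝ) y = y := by
  let f' : stab E x := ⟨f, hf⟩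
  let g' : stab E x := ⟨g, hg⟩
  have h : ((⁅f', g'⁆ : stab E x) : GermGroup E x) = 1 := by
    have := hag x (f' : GermGroup E x) (g' : GermGroup E x)
    rw [← QuotientGroup.mk'_apply, map_commutatorElement]
    exact commutatorElement_eq_one_iff_mul_comm.2 this
  exact (QuotientGroup.eq_one_iff _).1 h

/-- Germs at `a` and at `b` are abelian, so the commutator is trivial near both endpoints. -/
theorem commutator_compact_support (hag : HasAbelianGerms E) {a b : ℝ} (hab : a < b) {f g : E}
    (hf : f ∈ rigid E a b) (hg : g ∈ rigid E a b) :
    ∃ p q, a < p ∧ p < q ∧ q < b ∧ ⁅f, g⁆ ∈ rigid E p q := by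
  have hab' := mem_rigid_iff.1 (show ⁅f, g⁆ ∈ rigid E a b by
    rw [commutatorElement_def]
    exact mul_mem (mul_mem (mul_mem hf hg) (inv_mem hf)) (inv_mem hg))
  rw [mem_rigid_iff] at hf hg
  obtain ⟨U, hU, haU, hUf⟩ :=
    exists_fix_nhds_commutator hag (hf a (by simp)) (hg a (by simp))
  obtain ⟨W, hW, hbW, hWf⟩ :=
    exists_fix_nhds_commutator hag (hf b (by simp)) (hg b (by simp))
  obtain ⟨m, ham, hmb⟩ := exists_between hab
  obtain ⟨p, hap, hp⟩ := (mem_nhdsGE_iff_exists_mem_Ioc_Ico_subset ham).1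
    (mem_nhdsWithin_of_mem_nhds (hU.mem_nhds haU))
  obtain ⟨q, hqb, hq⟩ := (mem_nhdsLE_iff_exists_mem_Ico_Ioc_subset hmb).1
    (mem_nhdsWithin_of_mem_nhds (hW.mem_nhds hbW))
  obtain ⟨p', hp1, hp2⟩ := exists_between hap.1
  obtain ⟨q', hq1, hq2⟩ := exists_between hqb.2
  refine ⟨p', q', hp1, (hp2.trans_le hap.2).trans (hqb.1.trans_lt hq1), hq2, ?_⟩
  rw [mem_rigid_iff]
  intro x hx
  by_cases hxab : x ∈ Set.Ioo a b
  · rcases le_or_gt x p' with h | h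
    · exact hUf x (hp ⟨hxab.1.le, h.trans_lt hp2⟩)
    · have h' : q' ≤ x := not_lt.1 fun h' => hx ⟨h, h'⟩
      exact hWf x (hq ⟨hq1.trans_le h', hxab.2.le⟩)
  · exact hab' x hxab

/-- Some element of `E` maps `[a,b]` into its interior and is the identity on a subinterval. -/
theorem exists_shrink (hE : E ≤ homeoPlus) (hlm : LocallyMoving E) {a b : ℝ} (hab : a < b) :
    ∃ h : E, a < (h : ℝ ≃ₜ ℝ) a ∧ (h : ℝ ≃ₜ ℝ) b < b ∧ ∃ u v, a < u ∧ u < v ∧ v < b ∧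
      ∀ x ∈ Set.Ioo u v, (h : ℝ ≃ₜ ℝ) x = x := by
  obtain ⟨u, hau, hub⟩ := exists_between hab
  obtain ⟨v, huv, hvb⟩ := exists_between hub
  -- Two independent pushes: `f` moves `a` to the right inside [a-1,u], and `g` moves `b` to the
  -- left inside [v,b+1].
  obtain ⟨f, hf, hfa⟩ := exists_rigid_apply_gt hE hlm (x := a) (y := a) (a := a - 1) (b := u)
    ⟨by linarith, hau⟩ hau
  obtain ⟨g, hg, hgb⟩ := exists_rigid_apply_lt hE hlm (x := b) (y := b) (a := v) (b := b + 1)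
    ⟨hvb, by linarith⟩ hvb
  have hf' := mem_rigid_iff.1 hf
  have hg' := mem_rigid_iff.1 hg
  have hgv : v < (g : ℝ ≃ₜ ℝ) b := by
    have := strictMono_coe hE g hvb
    rwa [hg' v (by simp)] at this
  refine ⟨f * g, ?_, ?_, u, v, hau, huv, hvb, fun x hx => ?_⟩
  · rwa [coe_mul_apply, hg' a fun h => (hau.trans (huv.trans h.1)).false]
  · rwa [coe_mul_apply, hf' _ fun h => (huv.trans hgv |>.trans h.2).false]
  · rw [coe_mul_apply, hg' x fun h => (h.1.trans hx.2).false, hf' x fun h => (h.2.trans hx.1).false]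

/-- Every nontrivial subgroup of `E[a,b]` normalized by `E[a,b]` contains `E[a,b]'`. -/
theorem commutator_rigid_le (hE : E ≤ homeoPlus) (hlm : LocallyMoving E) (hag : HasAbelianGerms E)
    {a b : ℝ} (hab : a < b) {N : Subgroup E} (hNA : N ≤ rigid E a b)
    (hN : ∀ g ∈ rigid E a b, ∀ n ∈ N, g * n * g⁻¹ ∈ N) (hN1 : ∃ n ∈ N, n ≠ 1) :
    ⁅rigid E a b, rigid E a b⁆ ≤ N := by
  obtain ⟨n, hn, hn1⟩ := hN1
  obtain ⟨x, hnx⟩ := exists_apply_ne hn1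
  have hx : x ∈ Set.Ioo a b := by
    by_contra h
    exact hnx (mem_rigid_iff.1 (hNA hn) x h)
  have key : ∀ {p q : ℝ}, a < p → q < b → ∀ {f g : E}, f ∈ rigid E p q → g ∈ rigid E p q →
      ⁅f, g⁆ ∈ N := by
    intro p q hp hq f g hf hg
    -- Enlarging the interval to contain `x` ensures p' < q' even when [p,q] is degenerate.
    obtain ⟨p', hp1, hp2⟩ := exists_between (lt_min hp hx.1)
    obtain ⟨q', hq1, hq2⟩ := exists_between (max_lt hq hx.2)
    rw [lt_min_iff] at hp2
    rw [max_lt_iff] at hq1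
    have hm : rigid E p q ≤ rigid E p' q' := rigid_mono hp2.1.le hq1.1.le
    exact commutator_mem_of_compact_support hE hlm hN hn hx hnx hp1 (hp2.2.trans hq1.2) hq2
      (hm hf) (hm hg)
  rw [Subgroup.commutator_le]
  intro f hf g hg
  obtain ⟨p, q, hap, hpq, hqb, hfg⟩ := commutator_compact_support hag hab hf hg
  obtain ⟨h, hha, hhb, u, v, hau, huv, hvb, hh⟩ := exists_shrink hE hlm hab
  obtain ⟨a', b', ha', hb', c, hc, hcp, hcq⟩ :=
    exists_rigid_move_interval hE hlm hap hpq hqb hau huv hvb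
  set k := ⁅f, g⁆
  -- Although `f` and `g` may be supported up to the endpoints, their conjugates by `h` are not, so
  -- `key` applies. It remains to compare `k` with its conjugate.
  have hconj : h * k * h⁻¹ ∈ N := by
    have : h * k * h⁻¹ = ⁅h * f * h⁻¹, h * g * h⁻¹⁆ := by
      simp only [k, commutatorElement_def]; group
    rw [this]
    exact key hha hhb (conj_mem_rigid hE hf h) (conj_mem_rigid hE hg h)
  have hk₁ : c * k * c⁻¹ ∈ rigid E u v :=
    rigid_mono hcp.le hcq.le (conj_mem_rigid hE hfg c)
  have hhk : Commute h (c * k * c⁻¹) := by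
    refine commute_of_fix (s := (Set.Ioo u v)ᶜ) (t := Set.Ioo u v) disjoint_compl_left
      (fun x hx => hh x (not_not.1 hx)) (mem_rigid_iff.1 hk₁)
  have hd : h * c⁻¹ * h⁻¹ ∈ rigid E ((h : ℝ ≃ₜ ℝ) a') ((h : ℝ ≃ₜ ℝ) b') :=
    conj_mem_rigid hE (inv_mem hc) h
  have hha' : a < (h : ℝ ≃ₜ ℝ) a' := hha.trans (strictMono_coe hE h ha')
  have hhb' : (h : ℝ ≃ₜ ℝ) b' < b := (strictMono_coe hE h hb').trans hhb
  have h1 : ⁅h * c⁻¹ * h⁻¹, c * k * c⁻¹⁆ ∈ N :=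
    key (lt_min hha' hau) (max_lt hhb' hvb)
      (rigid_mono (min_le_left _ _) (le_max_left _ _) hd)
      (rigid_mono (min_le_right _ _) (le_max_right _ _) hk₁)
  have h2 : ⁅c * k * c⁻¹, c⁻¹⁆ ∈ N :=
    key (lt_min ha' hau) (max_lt hb' hvb)
      (rigid_mono (min_le_right _ _) (le_max_right _ _) hk₁)
      (rigid_mono (min_le_left _ _) (le_max_left _ _) (inv_mem hc))
  -- Put k₁ = c k c⁻¹. As `h` commutes with k₁, both k and h k h⁻¹ are conjugates of k₁, by c⁻¹ and
  -- by h c⁻¹ h⁻¹. Each differs from k₁ by a commutator of compactly supported elements.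
  have h3 : h * k * h⁻¹ * k⁻¹ ∈ N := by
    have : h * k * h⁻¹ * k⁻¹ = ⁅h * c⁻¹ * h⁻¹, c * k * c⁻¹⁆ * ⁅c * k * c⁻¹, c⁻¹⁆ := by
      have e : h⁻¹ * (c * k * c⁻¹) * h = c * k * c⁻¹ := by
        rw [mul_assoc, ← hhk.eq, inv_mul_cancel_left]
      calc h * k * h⁻¹ * k⁻¹ = h * c⁻¹ * (c * k * c⁻¹) * c * h⁻¹ * k⁻¹ := by group
        _ = h * c⁻¹ * (h⁻¹ * (c * k * c⁻¹) * h) * c * h⁻¹ * k⁻¹ := by rw [e]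
        _ = _ := by simp only [commutatorElement_def]; group
    rw [this]
    exact mul_mem h1 h2
  have h4 : k = (h * k * h⁻¹ * k⁻¹)⁻¹ * (h * k * h⁻¹) := by group
  rw [h4]
  exact mul_mem (inv_mem h3) hconj

/-- Choose `g` supported in an interval displaced by f^m. If the powers commuted, g^m would move f^m
y for each `y` it moves, yet f^m y lies outside that interval. -/
theorem exists_commutator_pow_ne_one (hE : E ≤ homeoPlus) (hlm : LocallyMoving E) {a b : ℝ}
    (hab : a < b) {m : ℕ} (hm : 0 < m) :
    ∃ f ∈ rigid E a b, ∃ g ∈ rigid E a b, ⁅f ^ m, g ^ m⁆ ≠ 1 := by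
  obtain ⟨f, hf, x, hx, hfx⟩ := exists_rigid_ne hlm hab
  obtain ⟨u, v, hau, huv, hvb, hdis⟩ := exists_displaced_interval hx (pow_apply_ne hE hfx hm)
  obtain ⟨g, hg, y, hy, hgy⟩ := exists_rigid_ne hlm huv
  refine ⟨f, hf, g, rigid_mono hau.le hvb.le hg, fun h => ?_⟩
  rw [commutatorElement_eq_one_iff_mul_comm] at h
  have h1 := congrArg (fun k : E => (k : ℝ ≃ₜ ℝ) y) h
  simp only [coe_mul_apply] at h1
  rw [mem_rigid_iff.1 (pow_mem hg m) _ (hdis y hy)] at h1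
  exact pow_apply_ne hE hgy hm (((f ^ m : E) : ℝ ≃ₜ ℝ).injective h1)

end

/-! ## Prefixes and cylinders -/

theorem prepend_apply_of_lt (w : List Bool) (x y : Cantor) {n : ℕ} (h : n < w.length) :
    prepend w x n = prepend w y n := by
  induction w generalizing n with
  | nil => simp at h
  | cons e w ih =>
    cases n with
    | zero => rfl
    | succ n => exact ih (by simpa using h)

theorem prepend_apply_add (w : List Bool) (x : Cantor) (n : ℕ) :
    prepend w x (w.length + n) = x n := by
  induction w with
  | nil => simp [prepend]
  | cons e w ih =>
    rw [List.length_cons, Nat.add_right_comm]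
    exact ih

theorem prepend_congr (w : List Bool) {x y : Cantor} {k : ℕ} (h : ∀ n < k, x n = y n) {n : ℕ}
    (hn : n < w.length + k) : prepend w x n = prepend w y n := by
  rcases lt_or_ge n w.length with h' | h'
  · exact prepend_apply_of_lt w x y h'
  · obtain ⟨m, rfl⟩ := Nat.exists_eq_add_of_le h'
    rw [prepend_apply_add, prepend_apply_add, h m (by omega)]

theorem prepend_injective (w : List Bool) : Function.Injective (prepend w) := fun x y h =>
  funext fun n => by rw [← prepend_apply_add w x, h, prepend_apply_add]

theorem eq_nil_of_prepend_eq {w : List Bool} (h : ∀ x, x = prepend w x) : w = [] := by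
  cases w with
  | nil => rfl
  | cons e w => exact absurd (congrFun (h fun _ => !e) 0) (by simp [prepend])

theorem eq_of_prepend_eq {v w : List Bool} (h : ∀ x, prepend v x = prepend w x) : v = w := by
  have aux : ∀ {v w : List Bool}, (∀ x, prepend v x = prepend w x) → (∃ s, v = w ++ s) →
      v = w := by
    rintro _ w h ⟨s, rfl⟩
    have : s = [] := eq_nil_of_prepend_eq fun x => prepend_injective w (by
      rw [← prepend_append, h])
    rw [this, List.append_nil]
  rcases prepend_compare v w _ _ (h fun _ => true) with ⟨s, hs, -⟩ | ⟨s, hs, -⟩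
  · exact aux h ⟨s, hs⟩
  · exact (aux (fun x => (h x).symm) ⟨s, hs⟩).symm

theorem exists_eq_append_of_length_le {v w : List Bool} {x y : Cantor}
    (h : prepend v x = prepend w y) (hl : w.length ≤ v.length) :
    ∃ s, v = w ++ s ∧ y = prepend s x := by
  rcases prepend_compare v w x y h with h' | ⟨s, rfl, rfl⟩
  · exact h'
  · have : s = [] := by
      rw [List.length_append] at hl
      exact List.length_eq_zero_iff.1 (by omega)
    subst this
    exact ⟨[], by simp, rfl⟩

/-- The finite word of the first `k` letters of an infinite sequence. -/
def initial (k : ℕ) (x : Cantor) : List Bool := List.ofFn fun i : Fin k => x i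

theorem length_initial (k : ℕ) (x : Cantor) : (initial k x).length = k := by simp [initial]

theorem exists_eq_prepend_initial (k : ℕ) (x : Cantor) : ∃ y, x = prepend (initial k x) y := by
  induction k generalizing x with
  | zero => exact ⟨x, by simp [initial, prepend]⟩
  | succ k ih =>
    obtain ⟨y, hy⟩ := ih fun n => x (n + 1)
    refine ⟨y, funext fun n => ?_⟩
    have h : initial (k + 1) x = x 0 :: initial k fun n => x (n + 1) := by simp [initial]
    rw [h]
    cases n with
    | zero => rfl
    | succ n => exact congrFun hy n

theorem isOpen_range_prepend (w : List Bool) : IsOpen (Set.range (prepend w)) := by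
  induction w with
  | nil =>
    have : Set.range (prepend []) = Set.univ := Set.range_eq_univ.2 fun x => ⟨x, rfl⟩
    rw [this]
    exact isOpen_univ
  | cons e w ih =>
    have : Set.range (prepend (e :: w)) =
        (fun x : Cantor => x 0) ⁻¹' {e} ∩ (fun x n => x (n + 1)) ⁻¹' Set.range (prepend w) := by
      ext x
      constructor
      · rintro ⟨y, rfl⟩
        exact ⟨rfl, y, rfl⟩
      · rintro ⟨h, y, hy⟩
        refine ⟨y, funext fun n => ?_⟩
        cases n with
        | zero => exact (Set.mem_singleton_iff.1 h).symm
        | succ n => exact congrFun hy n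
    rw [this]
    exact ((isOpen_discrete _).preimage (continuous_apply 0)).inter
      (ih.preimage (continuous_pi fun n => continuous_apply (n + 1)))

theorem exists_cylinder_subset {U : Set Cantor} (hU : IsOpen U) {x : Cantor} (hx : x ∈ U) :
    ∃ k, ∀ y : Cantor, (∀ n < k, y n = x n) → y ∈ U := by
  obtain ⟨_, ⟨z, k, rfl⟩, hxz, hsub⟩ :=
    (PiNat.isTopologicalBasis_cylinders fun _ : ℕ => Bool).exists_subset_of_mem_open hx hU
  rw [PiNat.mem_cylinder_iff_eq] at hxz
  exact ⟨k, fun y hy => hsub (hxz ▸ PiNat.mem_cylinder_iff.2 hy)⟩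

theorem iterate_prepend_agree {s : List Bool} (hs : s ≠ []) (k : ℕ) (x y : Cantor) :
    ∀ n < k, (prepend s)^[k] x n = (prepend s)^[k] y n := by
  induction k with
  | zero => intro n hn; omega
  | succ k ih =>
    intro n hn
    have := List.length_pos_iff.2 hs
    rw [Function.iterate_succ_apply', Function.iterate_succ_apply']
    exact prepend_congr s ih (by omega)

/-- The infinite word `sss…`. -/
def periodicWord (s : List Bool) : Cantor := fun n => (prepend s)^[n + 1] (fun _ => true) n

theorem iterate_prepend_apply {s : List Bool} (hs : s ≠ []) (k : ℕ) (x : Cantor) :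
    ∀ n < k, (prepend s)^[k] x n = periodicWord s n := by
  intro n hn
  obtain ⟨m, rfl⟩ := Nat.exists_eq_add_of_le (Nat.succ_le_of_lt hn)
  rw [Function.iterate_add_apply]
  exact iterate_prepend_agree hs (n + 1) _ _ n (Nat.lt_succ_self n)

theorem prepend_periodicWord {s : List Bool} (hs : s ≠ []) :
    prepend s (periodicWord s) = periodicWord s := by
  funext n
  rw [← iterate_prepend_apply hs (n + 1) (periodicWord s) n (Nat.lt_succ_self n),
    Function.iterate_succ_apply']
  have := List.length_pos_iff.2 hs
  exact prepend_congr s (k := n)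
    (fun m hm => (iterate_prepend_apply hs n (periodicWord s) m hm).symm) (by omega)

/-! ## The length cocycle of Thompson's group -/

/-- Near `x` the map `α` replaces a finite prefix by a word that is longer by `e`. -/
def HasExpansion (α : thompsonV) (x : Cantor) (e : ℤ) : Prop :=
  ∃ w u : List Bool, x ∈ Set.range (prepend w) ∧
    (∀ y, (α : Cantor ≃ₜ Cantor) (prepend w y) = prepend u y) ∧ e = u.length - w.length

/-- Lengthening the prefix by `s` lengthens its image by the same `s`, so the difference of lengths
is unchanged. -/
theorem HasExpansion.unique {α : thompsonV} {x : Cantor} {d e : ℤ} (hd : HasExpansion α x d)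
    (he : HasExpansion α x e) : d = e := by
  have aux : ∀ {w u v t : List Bool}, (∀ y, (α : Cantor ≃ₜ Cantor) (prepend w y) = prepend u y) →
      (∀ y, (α : Cantor ≃ₜ Cantor) (prepend v y) = prepend t y) → (∃ s, w = v ++ s) →
      (u.length : ℤ) - w.length = t.length - v.length := by
    rintro _ u v t h1 h2 ⟨s, rfl⟩
    have : u = t ++ s := eq_of_prepend_eq fun y => by
      rw [← h1, prepend_append, prepend_append, h2]
    rw [this, List.length_append, List.length_append]
    push_cast
    ring
  obtain ⟨w, u, ⟨y, rfl⟩, h1, rfl⟩ := hd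
  obtain ⟨v, t, ⟨z, hz⟩, h2, rfl⟩ := he
  rcases prepend_compare w v y z hz.symm with ⟨s, hs, -⟩ | ⟨s, hs, -⟩
  · exact aux h1 h2 ⟨s, hs⟩
  · exact (aux h2 h1 ⟨s, hs⟩).symm

theorem exists_hasExpansion (α : thompsonV) (x : Cantor) : ∃ e, HasExpansion α x e := by
  obtain ⟨w, u, ⟨y, hy⟩, h⟩ := α.2 x
  exact ⟨_, w, u, ⟨y, hy.symm⟩, h, rfl⟩

/-- The logarithmic derivative of `α` at `x`: the length by which `α` expands prefixes of `x`. -/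
noncomputable def expansion (α : thompsonV) (x : Cantor) : ℤ := (exists_hasExpansion α x).choose

theorem hasExpansion_expansion (α : thompsonV) (x : Cantor) : HasExpansion α x (expansion α x) :=
  (exists_hasExpansion α x).choose_spec

theorem expansion_eq {α : thompsonV} {x : Cantor} {e : ℤ} (h : HasExpansion α x e) :
    expansion α x = e := (hasExpansion_expansion α x).unique h

theorem expansion_prepend {α : thompsonV} {w u : List Bool}
    (h : ∀ y, (α : Cantor ≃ₜ Cantor) (prepend w y) = prepend u y) (y : Cantor) :
    expansion α (prepend w y) = u.length - w.length :=
  expansion_eq ⟨w, u, ⟨y, rfl⟩, h, rfl⟩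

theorem expansion_one (x : Cantor) : expansion 1 x = 0 :=
  expansion_eq ⟨[], [], ⟨x, rfl⟩, fun _ => rfl, by simp⟩

/-- This is the chain rule: extend one of the two prefix replacements until they can be composed. -/
theorem expansion_mul (α β : thompsonV) (x : Cantor) :
    expansion (α * β) x = expansion α ((β : Cantor ≃ₜ Cantor) x) + expansion β x := by
  obtain ⟨w, u, ⟨y, rfl⟩, h, he⟩ := hasExpansion_expansion β x
  obtain ⟨v, t, ⟨z, hz⟩, h', he'⟩ :=
    hasExpansion_expansion α ((β : Cantor ≃ₜ Cantor) (prepend w y))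
  rw [he, he', expansion_eq]
  rw [h] at hz
  rcases prepend_compare v u z y hz with ⟨s, rfl, rfl⟩ | ⟨s, rfl, rfl⟩
  · refine ⟨w ++ s, t, ⟨z, by rw [prepend_append]⟩, fun x => ?_, ?_⟩
    · rw [coe_mul_apply, prepend_append, h, ← prepend_append, h']
    · simp only [List.length_append]; push_cast; ring
  · refine ⟨w, t ++ s, ⟨y, rfl⟩, fun x => ?_, ?_⟩
    · rw [coe_mul_apply, h, prepend_append, h', prepend_append]
    · simp only [List.length_append]; push_cast; ring

theorem expansion_inv (α : thompsonV) (x : Cantor) :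
    expansion α⁻¹ ((α : Cantor ≃ₜ Cantor) x) = -expansion α x := by
  have := expansion_mul α⁻¹ α x
  rw [inv_mul_cancel, expansion_one] at this
  omega

theorem expansion_conj (α β : thompsonV) (x : Cantor) (h : Commute α β) :
    expansion α ((β : Cantor ≃ₜ Cantor) x) + expansion β x =
      expansion β ((α : Cantor ≃ₜ Cantor) x) + expansion α x := by
  rw [← expansion_mul, ← expansion_mul, h.eq]

theorem pow_apply_fixed {α : thompsonV} {x : Cantor} (h : (α : Cantor ≃ₜ Cantor) x = x) (n : ℕ) :
    ((α ^ n : thompsonV) : Cantor ≃ₜ Cantor) x = x := by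
  rw [coe_pow_apply]
  exact Function.iterate_fixed h n

theorem zpow_apply_fixed {α : thompsonV} {x : Cantor} (h : (α : Cantor ≃ₜ Cantor) x = x) (n : ℤ) :
    ((α ^ n : thompsonV) : Cantor ≃ₜ Cantor) x = x := by
  have h' : ((α⁻¹ : thompsonV) : Cantor ≃ₜ Cantor) x = x := (coe_inv_apply_eq_iff α).2 h.symm
  cases n with
  | ofNat n => exact pow_apply_fixed h n
  | negSucc n =>
    rw [zpow_negSucc, ← inv_pow]
    exact pow_apply_fixed h' _

theorem expansion_zpow_fixed {α : thompsonV} {x : Cantor} (h : (α : Cantor ≃ₜ Cantor) x = x)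
    (n : ℤ) : expansion (α ^ n) x = n * expansion α x := by
  induction n using Int.induction_on with
  | zero => simp [expansion_one]
  | succ n ih => rw [zpow_add_one, expansion_mul, h, ih]; ring
  | pred n ih =>
    have h' : ((α⁻¹ : thompsonV) : Cantor ≃ₜ Cantor) x = x := (coe_inv_apply_eq_iff α).2 h.symm
    have h2 := expansion_inv α x
    rw [h] at h2
    rw [zpow_sub_one, expansion_mul, h', ih, h2]; ring

/-- An element of `V` that fixes `x` with zero expansion is the identity near `x`. -/
theorem exists_nhds_fix {α : thompsonV} {x : Cantor} (h : (α : Cantor ≃ₜ Cantor) x = x)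
    (he : expansion α x = 0) :
    ∃ p, x ∈ Set.range (prepend p) ∧ ∀ y, (α : Cantor ≃ₜ Cantor) (prepend p y) = prepend p y := by
  obtain ⟨w, u, ⟨y, rfl⟩, h', he'⟩ := hasExpansion_expansion α x
  have hl : w.length = u.length := by omega
  rw [h'] at h
  obtain ⟨s, rfl, -⟩ := exists_eq_append_of_length_le h hl.le
  have : s = [] := by
    rw [List.length_append] at hl
    exact List.length_eq_zero_iff.1 (by omega)
  subst this
  exact ⟨w, ⟨y, rfl⟩, fun y => by rw [h', List.append_nil]⟩

/-! ## Dynamics of one element -/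

/-- By compactness, finitely many prefix replacements describe `α`. -/
theorem exists_uniform_depth (α : thompsonV) : ∃ D : ℕ, ∀ p : List Bool, D ≤ p.length →
    ∃ u, ∀ y, (α : Cantor ≃ₜ Cantor) (prepend p y) = prepend u y := by
  have key : ∃ D : ℕ, ∀ p : List Bool, D ≤ p.length →
      (Set.range (prepend p) ∩ Set.univ).Nonempty →
      ∃ u, ∀ y, (α : Cantor ≃ₜ Cantor) (prepend p y) = prepend u y := by
    refine isCompact_univ.induction_on (p := fun s => ∃ D : ℕ, ∀ p : List Bool, D ≤ p.length →
      (Set.range (prepend p) ∩ s).Nonempty →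
      ∃ u, ∀ y, (α : Cantor ≃ₜ Cantor) (prepend p y) = prepend u y) ?_ ?_ ?_ ?_
    · exact ⟨0, fun p _ h => by simp at h⟩
    · rintro s t hst ⟨D, hD⟩
      exact ⟨D, fun p hp h => hD p hp (h.mono (Set.inter_subset_inter_right _ hst))⟩
    · rintro s t ⟨D, hD⟩ ⟨D', hD'⟩
      refine ⟨max D D', fun p hp h => ?_⟩
      rw [Set.inter_union_distrib_left, Set.union_nonempty] at h
      rcases h with h | h
      · exact hD p ((le_max_left _ _).trans hp) h
      · exact hD' p ((le_max_right _ _).trans hp) h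
    · intro x _
      obtain ⟨w, u, ⟨y, hy⟩, h⟩ := α.2 x
      refine ⟨Set.range (prepend w), mem_nhdsWithin_of_mem_nhds
        ((isOpen_range_prepend w).mem_nhds ⟨y, hy.symm⟩), w.length, ?_⟩
      rintro p hp ⟨_, ⟨a, rfl⟩, ⟨b, hb⟩⟩
      obtain ⟨s, rfl, -⟩ := exists_eq_append_of_length_le hb.symm hp
      exact ⟨u ++ s, fun y => by rw [prepend_append, h, prepend_append]⟩
  obtain ⟨D, hD⟩ := key
  exact ⟨D, fun p hp => hD p hp ⟨prepend p fun _ => true, ⟨_, rfl⟩, trivial⟩⟩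

/-- Nonnegative expansion keeps every intermediate word at least as long as `p`, hence deep enough
for `α` to act on it as another prefix replacement. -/
theorem exists_pow_prepend {α : thompsonV} {D : ℕ} (hD : ∀ p : List Bool, D ≤ p.length →
    ∃ u, ∀ y, (α : Cantor ≃ₜ Cantor) (prepend p y) = prepend u y) {p : List Bool}
    (hp : D ≤ p.length) (x : Cantor) (n : ℕ) (h : ∀ k ≤ n, 0 ≤ expansion (α ^ k) (prepend p x)) :
    ∃ v, p.length ≤ v.length ∧
      ∀ y, ((α ^ n : thompsonV) : Cantor ≃ₜ Cantor) (prepend p y) = prepend v y := by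
  have key : ∃ v, ∀ y, ((α ^ n : thompsonV) : Cantor ≃ₜ Cantor) (prepend p y) = prepend v y := by
    induction n with
    | zero => exact ⟨p, fun y => rfl⟩
    | succ n ih =>
      obtain ⟨v, hv⟩ := ih fun k hk => h k (by omega)
      have h1 := expansion_prepend hv x
      have h2 := h n (by omega)
      obtain ⟨u, hu⟩ := hD v (by omega)
      exact ⟨u, fun y => by rw [pow_succ', coe_mul_apply, hv, hu]⟩
  obtain ⟨v, hv⟩ := key
  have h1 := expansion_prepend hv x
  have h2 := h n le_rfl
  exact ⟨v, by omega, hv⟩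

/-- Among the times coloured by finitely many colours there are two of the same colour such that an
integer sequence attains its minimum over the interval between them at one of its ends. -/
theorem exists_lt_min_at_end {C : Type*} [Finite C] (c : ℕ → C) (e : ℕ → ℤ) :
    ∃ i j, i < j ∧ c i = c j ∧
      ((∀ k, i ≤ k → k ≤ j → e i ≤ e k) ∨ ∀ k, i ≤ k → k ≤ j → e j ≤ e k) := by
  by_cases hb : ∃ b, ∀ n, b ≤ e n
  · have hinf : {i | ∀ k, i ≤ k → e i ≤ e k}.Infinite := by
      rw [← Nat.frequently_atTop_iff_infinite, Filter.frequently_atTop]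
      intro M
      obtain ⟨b, hb⟩ := hb
      obtain ⟨l, ⟨i, hi, rfl⟩, hl⟩ := Int.exists_least_of_bdd (P := fun z => ∃ i ≥ M, e i = z)
        ⟨b, by rintro _ ⟨i, -, rfl⟩; exact hb i⟩ ⟨e M, M, le_rfl, rfl⟩
      exact ⟨i, hi, fun k hk => hl _ ⟨k, hi.trans hk, rfl⟩⟩
    obtain ⟨i, hi, j, -, hij, hc⟩ := hinf.exists_lt_map_eq_of_mapsTo
      (f := c) (t := Set.univ) (fun _ _ => trivial) Set.finite_univ
    exact ⟨i, j, hij, hc, Or.inl fun k hk _ => hi k hk⟩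
  · have hinf : {j | ∀ k, k ≤ j → e j ≤ e k}.Infinite := by
      rw [← Nat.frequently_atTop_iff_infinite, Filter.frequently_atTop]
      intro M
      obtain ⟨b, hbM⟩ := ((Set.finite_Iic M).image e).bddBelow
      push Not at hb
      have hex : ∃ n, e n < b := hb b
      classical
      refine ⟨Nat.find hex, ?_, fun k hk => ?_⟩
      · by_contra h
        exact (Nat.find_spec hex).not_ge (hbM ⟨_, (not_le.1 h).le, rfl⟩)
      · rcases hk.eq_or_lt with rfl | hk
        · exact le_rfl
        · exact (Nat.find_spec hex).le.trans (not_lt.1 (Nat.find_min hex hk))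
    obtain ⟨i, -, j, hj, hij, hc⟩ := hinf.exists_lt_map_eq_of_mapsTo
      (f := c) (t := Set.univ) (fun _ _ => trivial) Set.finite_univ
    exact ⟨i, j, hij, hc, Or.inr fun k _ hk => hj k hk⟩

/-- The points near which some nontrivial power of `α` is the identity. -/
def torsionPart (α : thompsonV) : Set Cantor :=
  {x | ∃ n : ℤ, n ≠ 0 ∧ ((α ^ n : thompsonV) : Cantor ≃ₜ Cantor) x = x ∧ expansion (α ^ n) x = 0}

/-- The attracting and repelling periodic points of `α`. -/
def hyperbolicPoints (α : thompsonV) : Set Cantor :=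
  {x | ∃ n : ℤ, n ≠ 0 ∧ ((α ^ n : thompsonV) : Cantor ≃ₜ Cantor) x = x ∧ expansion (α ^ n) x ≠ 0}

/-- Some power of `α` maps the cylinder of `p` into itself as `p y ↦ p s y`, with `s` nonempty,
and some point of the orbit of `x` lies in the cylinder. -/
def InBasin (α : thompsonV) (x : Cantor) (n i : ℤ) (p s : List Bool) : Prop :=
  n ≠ 0 ∧ s ≠ [] ∧ ((α ^ i : thompsonV) : Cantor ≃ₜ Cantor) x ∈ Set.range (prepend p) ∧
    ∀ y, ((α ^ n : thompsonV) : Cantor ≃ₜ Cantor) (prepend p y) = prepend p (prepend s y)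

theorem zpow_apply_zpow (α : thompsonV) (i n : ℤ) (x : Cantor) :
    ((α ^ n : thompsonV) : Cantor ≃ₜ Cantor) (((α ^ i : thompsonV) : Cantor ≃ₜ Cantor) x) =
      ((α ^ (n + i) : thompsonV) : Cantor ≃ₜ Cantor) x := by
  rw [zpow_add, coe_mul_apply]

theorem commute_apply {α β : thompsonV} (h : Commute α β) (x : Cantor) :
    (α : Cantor ≃ₜ Cantor) ((β : Cantor ≃ₜ Cantor) x) =
      (β : Cantor ≃ₜ Cantor) ((α : Cantor ≃ₜ Cantor) x) := by
  rw [← coe_mul_apply, h.eq, coe_mul_apply]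

/-- At a fixed point of `α`, the expansion of `α` is invariant under the centralizer. -/
theorem commute_fixed {α β : thompsonV} (h : Commute α β) {x : Cantor}
    (hx : (α : Cantor ≃ₜ Cantor) x = x) :
    (α : Cantor ≃ₜ Cantor) ((β : Cantor ≃ₜ Cantor) x) = (β : Cantor ≃ₜ Cantor) x ∧
      expansion α ((β : Cantor ≃ₜ Cantor) x) = expansion α x := by
  have h1 := commute_apply h x
  have h2 := expansion_conj α β x h
  rw [hx] at h1 h2
  exact ⟨h1, by omega⟩

theorem commute_mem_torsionPart {α β : thompsonV} (h : Commute α β) {x : Cantor}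
    (hx : x ∈ torsionPart α) : (β : Cantor ≃ₜ Cantor) x ∈ torsionPart α := by
  obtain ⟨n, hn, h1, h2⟩ := hx
  have := commute_fixed (h.zpow_left n) h1
  exact ⟨n, hn, this.1, this.2.trans h2⟩

theorem commute_mem_hyperbolicPoints {α β : thompsonV} (h : Commute α β) {x : Cantor}
    (hx : x ∈ hyperbolicPoints α) : (β : Cantor ≃ₜ Cantor) x ∈ hyperbolicPoints α := by
  obtain ⟨n, hn, h1, h2⟩ := hx
  have := commute_fixed (h.zpow_left n) h1
  exact ⟨n, hn, this.1, this.2 ▸ h2⟩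

theorem mem_torsionPart_of_zpow {α : thompsonV} {x : Cantor} {i : ℤ}
    (h : ((α ^ i : thompsonV) : Cantor ≃ₜ Cantor) x ∈ torsionPart α) : x ∈ torsionPart α := by
  have := commute_mem_torsionPart ((Commute.refl α).zpow_right (-i)) h
  rwa [zpow_apply_zpow, neg_add_cancel, zpow_zero] at this

/-- The words `p` and `v` are prefixes of one point, so `v` extends `p`: equality gives torsion,
proper extension gives contraction. -/
theorem torsion_or_inBasin_of_return {α : thompsonV} {x : Cantor} {n i : ℤ} (hn : n ≠ 0)
    {p v : List Bool} (hpv : p.length ≤ v.length)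
    (hx : ((α ^ i : thompsonV) : Cantor ≃ₜ Cantor) x ∈ Set.range (prepend p))
    (hnx : ((α ^ (n + i) : thompsonV) : Cantor ≃ₜ Cantor) x ∈ Set.range (prepend p))
    (h : ∀ y, ((α ^ n : thompsonV) : Cantor ≃ₜ Cantor) (prepend p y) = prepend v y) :
    x ∈ torsionPart α ∨ ∃ n i p s, InBasin α x n i p s := by
  obtain ⟨y, hy⟩ := hx
  obtain ⟨z, hz⟩ := hnx
  rw [← zpow_apply_zpow, ← hy, h] at hz
  obtain ⟨s, rfl, -⟩ := exists_eq_append_of_length_le hz.symm hpv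
  by_cases hs : s = []
  · subst hs
    rw [List.append_nil] at h
    refine Or.inl (mem_torsionPart_of_zpow (i := i) ⟨n, hn, ?_, ?_⟩)
    · rw [← hy, h]
    · rw [← hy, expansion_prepend h, sub_self]
  · exact Or.inr ⟨n, i, p, s, hn, hs, ⟨y, hy⟩, fun y => by rw [h, prepend_append]⟩

/-- Colour times by the first `D` letters of the orbit point. Two times of equal colour with minimal
expansion at an end give a return to a cylinder along which prefixes never become shorter than at
the start, read forwards with `α` or backwards with its inverse. -/
theorem torsion_or_inBasin (α : thompsonV) (x : Cantor) :
    x ∈ torsionPart α ∨ ∃ n i p s, InBasin α x n i p s := by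
  obtain ⟨D₁, hD₁⟩ := exists_uniform_depth α
  obtain ⟨D₂, hD₂⟩ := exists_uniform_depth α⁻¹
  set D := max D₁ D₂
  set X : ℕ → Cantor := fun n => ((α ^ n : thompsonV) : Cantor ≃ₜ Cantor) x with hX
  have hXX : ∀ n k, ((α ^ k : thompsonV) : Cantor ≃ₜ Cantor) (X n) = X (k + n) := by
    intro n k
    simp only [hX]
    rw [pow_add, coe_mul_apply]
  have hexp : ∀ n k, expansion (α ^ (k + n)) x = expansion (α ^ k) (X n) + expansion (α ^ n) x := by
    intro n k
    rw [pow_add, expansion_mul]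
  obtain ⟨i, j, hij, hc, h⟩ := exists_lt_min_at_end (fun n => fun i : Fin D => X n i)
    (fun n => expansion (α ^ n) x)
  have hini : initial D (X i) = initial D (X j) := congrArg List.ofFn hc
  have hD := length_initial D (X i)
  obtain ⟨y, hy⟩ := exists_eq_prepend_initial D (X i)
  obtain ⟨z, hz⟩ := exists_eq_prepend_initial D (X j)
  rw [← hini] at hz
  set p := initial D (X i)
  obtain ⟨m, rfl⟩ := Nat.exists_eq_add_of_le' hij.le
  have hm : (m : ℤ) ≠ 0 := by omega
  rcases h with h | h
  · obtain ⟨v, hpv, hv⟩ := exists_pow_prepend hD₁ (p := p) (by omega) y m fun k hk => by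
      have h1 := h (k + i) (by omega) (by omega)
      rw [hexp, hy] at h1
      omega
    refine torsion_or_inBasin_of_return (n := m) (i := i) hm hpv ⟨y, ?_⟩ ⟨z, ?_⟩ ?_
    · rw [zpow_natCast, ← hy]
    · rw [← Nat.cast_add, zpow_natCast, ← hz]
    · simpa only [zpow_natCast] using hv
  · obtain ⟨v, hpv, hv⟩ := exists_pow_prepend hD₂ (p := p) (by omega) z m fun k hk => by
      have h1 := h (m - k + i) (by omega) (by omega)
      have h2 := hexp (m - k + i) k
      have h3 := expansion_inv (α ^ k) (X (m - k + i))
      rw [hXX] at h3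
      rw [show k + (m - k + i) = m + i by omega] at h2 h3
      rw [← hz, inv_pow, h3]
      omega
    refine torsion_or_inBasin_of_return (n := -m) (i := (m + i : ℕ)) (by omega) hpv
      ⟨z, ?_⟩ ⟨y, ?_⟩ ?_
    · rw [zpow_natCast, ← hz]
    · rw [Nat.cast_add, neg_add_cancel_left, zpow_natCast, ← hy]
    · simpa only [zpow_neg, zpow_natCast, inv_pow] using hv

theorem iterate_prepend_eq {α : thompsonV} {p s : List Bool}
    (h : ∀ y, (α : Cantor ≃ₜ Cantor) (prepend p y) = prepend p (prepend s y)) (k : ℕ) (y : Cantor) :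
    ((α ^ k : thompsonV) : Cantor ≃ₜ Cantor) (prepend p y) = prepend p ((prepend s)^[k] y) := by
  induction k with
  | zero => rfl
  | succ k ih => rw [pow_succ', coe_mul_apply, ih, h, Function.iterate_succ_apply']

theorem expansion_pow_prepend {α : thompsonV} {p s : List Bool}
    (h : ∀ y, (α : Cantor ≃ₜ Cantor) (prepend p y) = prepend p (prepend s y)) (k : ℕ) (y : Cantor) :
    expansion (α ^ k) (prepend p y) = k * s.length := by
  induction k with
  | zero => simp [expansion_one]
  | succ k ih =>
    have h1 : ∀ y, (α : Cantor ≃ₜ Cantor) (prepend p y) = prepend (p ++ s) y := fun y => by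
      rw [h, prepend_append]
    rw [pow_succ', expansion_mul, ih, iterate_prepend_eq h, expansion_prepend h1,
      List.length_append]
    push_cast
    ring

/-- The periodic point that attracts the cylinder. -/
theorem InBasin.mem_hyperbolicPoints {α : thompsonV} {x : Cantor} {n i : ℤ} {p s : List Bool}
    (h : InBasin α x n i p s) : prepend p (periodicWord s) ∈ hyperbolicPoints α := by
  obtain ⟨hn, hs, -, h⟩ := h
  refine ⟨n, hn, by rw [h, prepend_periodicWord hs], ?_⟩
  have := expansion_pow_prepend h 1 (periodicWord s)
  rw [pow_one] at this
  have := List.length_pos_iff.2 hs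
  omega

/-- An element that commutes with `α` and is trivial near the attracting point of a basin is
trivial on the basin. -/
theorem InBasin.apply_eq {α β : thompsonV} {x : Cantor} {n i : ℤ} {p s : List Bool}
    (h : InBasin α x n i p s) (hαβ : Commute α β)
    (hβ : (β : Cantor ≃ₜ Cantor) (prepend p (periodicWord s)) = prepend p (periodicWord s))
    (hβe : expansion β (prepend p (periodicWord s)) = 0) : (β : Cantor ≃ₜ Cantor) x = x := by
  obtain ⟨q, hq, hqβ⟩ := exists_nhds_fix hβ hβe
  obtain ⟨k, hk⟩ := exists_cylinder_subset (isOpen_range_prepend q) hq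
  obtain ⟨hn, hs, ⟨y, hy⟩, h⟩ := h
  -- Enough contractions carry `x` into the cylinder of `q`, where `β` is trivial; commutation
  -- transports this back to `x`.
  have h1 : ((α ^ n) ^ k * α ^ i : thompsonV).1 x ∈ Set.range (prepend q) := by
    refine hk _ fun m hm => ?_
    rw [coe_mul_apply, ← hy, iterate_prepend_eq h]
    exact prepend_congr p (k := k) (iterate_prepend_apply hs k y) (by omega)
  obtain ⟨z, hz⟩ := h1
  have h2 : Commute ((α ^ n) ^ k * α ^ i) β :=
    ((hαβ.zpow_left n).pow_left k).mul_left (hαβ.zpow_left i)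
  have h3 := commute_apply h2 x
  rw [← hz, hqβ, hz] at h3
  exact ((α ^ n) ^ k * α ^ i : thompsonV).1.injective h3

/-- A common power would have zero expansion by torsion and positive expansion by contraction. -/
theorem InBasin.notMem_torsionPart {α : thompsonV} {x : Cantor} {n i : ℤ} {p s : List Bool}
    (h : InBasin α x n i p s) : x ∉ torsionPart α := by
  intro hx
  obtain ⟨hn, hs, ⟨y, hy⟩, h⟩ := h
  have hx' := commute_mem_torsionPart ((Commute.refl α).zpow_right i) hx
  rw [← hy] at hx'
  obtain ⟨m, hm, h1, h2⟩ := hx'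
  -- The sign makes the common power a natural power of α^n, so that the contraction can be
  -- iterated.
  have h3 := expansion_zpow_fixed h1 (n * m.sign)
  have h4 := expansion_pow_prepend h m.natAbs y
  have h5 : (α ^ m) ^ (n * m.sign) = (α ^ n) ^ m.natAbs := by
    rw [← zpow_natCast, ← zpow_mul, ← zpow_mul, ← Int.sign_mul_self_eq_natAbs]
    ring_nf
  rw [h5, h2, h4, mul_zero] at h3
  have h6 := List.length_pos_iff.2 hs
  have h7 := Int.natAbs_pos.2 hm
  have : (0 : ℤ) < m.natAbs * s.length := by positivity
  omega

/-- A periodic point in a basin is the attracting point. -/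
theorem InBasin.eq_of_periodic {α : thompsonV} {x : Cantor} {n i : ℤ} {p s : List Bool}
    (h : InBasin α x n i p s) (hx : x ∈ hyperbolicPoints α) :
    ((α ^ i : thompsonV) : Cantor ≃ₜ Cantor) x = prepend p (periodicWord s) := by
  obtain ⟨hn, hs, ⟨y, hy⟩, h⟩ := h
  obtain ⟨m, hm, h1, -⟩ := commute_mem_hyperbolicPoints ((Commute.refl α).zpow_right i) hx
  rw [← hy] at h1 ⊢
  funext k
  -- The factor k + 1 provides enough contractions to determine the letter at position k.
  have h2 := zpow_apply_fixed h1 (n * m.sign * (k + 1))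
  have h5 : (α ^ m) ^ (n * m.sign * (k + 1)) = (α ^ n) ^ (m.natAbs * (k + 1)) := by
    rw [← zpow_natCast, ← zpow_mul, ← zpow_mul, Nat.cast_mul, ← Int.sign_mul_self_eq_natAbs]
    push_cast
    ring_nf
  rw [h5, iterate_prepend_eq h] at h2
  rw [← h2]
  have h7 := Int.natAbs_pos.2 hm
  have h8 : k + 1 ≤ m.natAbs * (k + 1) := Nat.le_mul_of_pos_left _ h7
  exact prepend_congr p (iterate_prepend_apply hs _ y) (by omega)

theorem hyperbolicPoints_disjoint_torsionPart (α : thompsonV) :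
    Disjoint (hyperbolicPoints α) (torsionPart α) := by
  rw [Set.disjoint_left]
  rintro x ⟨n, -, h1, h2⟩ ⟨m, hm, h3, h4⟩
  have h5 := expansion_zpow_fixed h1 m
  have h6 := expansion_zpow_fixed h3 n
  rw [← zpow_mul, mul_comm m n, zpow_mul, h5, h4, mul_zero] at h6
  exact (mul_ne_zero hm h2) h6

theorem inBasin_nhds {α : thompsonV} {x : Cantor} {n i : ℤ} {p s : List Bool}
    (h : InBasin α x n i p s) : {y | InBasin α y n i p s} ∈ nhds x := by
  obtain ⟨hn, hs, hx, h⟩ := h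
  refine Filter.mem_of_superset (((isOpen_range_prepend p).preimage
    ((α ^ i : thompsonV) : Cantor ≃ₜ Cantor).continuous).mem_nhds hx) fun y hy => ?_
  exact ⟨hn, hs, hy, h⟩

theorem torsion_nhds {α : thompsonV} {x : Cantor} (hx : x ∈ torsionPart α) :
    ∃ n : ℕ, 0 < n ∧ {y | y ∈ torsionPart α ∧
      ((α ^ n : thompsonV) : Cantor ≃ₜ Cantor) y = y} ∈ nhds x := by
  obtain ⟨n, hn, h1, h2⟩ := hx
  obtain ⟨p, hp, h⟩ := exists_nhds_fix h1 h2
  refine ⟨n.natAbs, Int.natAbs_pos.2 hn,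
    Filter.mem_of_superset ((isOpen_range_prepend p).mem_nhds hp) ?_⟩
  rintro _ ⟨y, rfl⟩
  refine ⟨⟨n, hn, h y, by rw [expansion_prepend h, sub_self]⟩, ?_⟩
  have := zpow_apply_fixed (h y) n.sign
  rwa [← zpow_mul, mul_comm, Int.sign_mul_self_eq_natAbs, zpow_natCast] at this

/-- Locally there is at most one: none near a torsion point, and in a basin only the point that α^i
carries to the attractor. Compactness concludes. -/
theorem finite_hyperbolicPoints (α : thompsonV) : (hyperbolicPoints α).Finite := by
  have key : (hyperbolicPoints α ∩ Set.univ).Finite := by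
    refine isCompact_univ.induction_on (p := fun s => (hyperbolicPoints α ∩ s).Finite)
      (by simp) (fun s t hst ht => ht.subset (Set.inter_subset_inter_right _ hst))
      (fun s t hs ht => by rw [Set.inter_union_distrib_left]; exact hs.union ht) fun x _ => ?_
    rcases torsion_or_inBasin α x with hx | ⟨n, i, p, s, h⟩
    · obtain ⟨n, -, hU⟩ := torsion_nhds hx
      refine ⟨_, mem_nhdsWithin_of_mem_nhds hU, Set.Finite.subset Set.finite_empty ?_⟩
      rintro y ⟨hy, hy', -⟩
      exact (hyperbolicPoints_disjoint_torsionPart α).le_bot ⟨hy, hy'⟩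
    · refine ⟨_, mem_nhdsWithin_of_mem_nhds (inBasin_nhds h), Set.Subsingleton.finite ?_⟩
      rintro y ⟨hy, hy'⟩ z ⟨hz, hz'⟩
      exact ((α ^ i : thompsonV) : Cantor ≃ₜ Cantor).injective
        ((hy'.eq_of_periodic hy).trans (hz'.eq_of_periodic hz).symm)
  rwa [Set.inter_univ] at key

theorem exists_pow_fix_torsionPart (α : thompsonV) : ∃ N : ℕ, 0 < N ∧ ∀ x ∈ torsionPart α,
    ((α ^ N : thompsonV) : Cantor ≃ₜ Cantor) x = x := by
  have key : ∃ N : ℕ, 0 < N ∧ ∀ x ∈ Set.univ, x ∈ torsionPart α →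
      ((α ^ N : thompsonV) : Cantor ≃ₜ Cantor) x = x := by
    refine isCompact_univ.induction_on (p := fun s => ∃ N : ℕ, 0 < N ∧ ∀ x ∈ s, x ∈ torsionPart α →
      ((α ^ N : thompsonV) : Cantor ≃ₜ Cantor) x = x) ⟨1, one_pos, by simp⟩ ?_ ?_ ?_
    · rintro s t hst ⟨N, hN, h⟩
      exact ⟨N, hN, fun x hx => h x (hst hx)⟩
    · rintro s t ⟨N, hN, h⟩ ⟨M, hM, h'⟩
      refine ⟨N * M, Nat.mul_pos hN hM, fun x hx hxα => ?_⟩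
      rcases hx with hx | hx
      · rw [pow_mul]
        exact pow_apply_fixed (h x hx hxα) M
      · rw [mul_comm, pow_mul]
        exact pow_apply_fixed (h' x hx hxα) N
    · intro x _
      rcases torsion_or_inBasin α x with hx | ⟨n, i, p, s, h⟩
      · obtain ⟨n, hn, hU⟩ := torsion_nhds hx
        exact ⟨_, mem_nhdsWithin_of_mem_nhds hU, n, hn, fun y hy _ => hy.2⟩
      · exact ⟨_, mem_nhdsWithin_of_mem_nhds (inBasin_nhds h), 1, one_pos,
          fun y hy hy' => (InBasin.notMem_torsionPart hy hy').elim⟩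
  obtain ⟨N, hN, h⟩ := key
  exact ⟨N, hN, fun x => h x trivial⟩

/-- If `β` commutes with `α` and is trivial near the attracting and repelling periodic points of
`α`, then it moves only points at which `α` is torsion. -/
theorem mem_torsionPart_of_commute {α β : thompsonV} (hαβ : Commute α β)
    (hβ : ∀ x ∈ hyperbolicPoints α, (β : Cantor ≃ₜ Cantor) x = x ∧ expansion β x = 0) {x : Cantor}
    (hx : (β : Cantor ≃ₜ Cantor) x ≠ x) : x ∈ torsionPart α := by
  rcases torsion_or_inBasin α x with h | ⟨n, i, p, s, h⟩
  · exact h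
  · have := hβ _ h.mem_hyperbolicPoints
    exact absurd (h.apply_eq hαβ this.1 this.2) hx

/-! ## Commuting subgroups of Thompson's group -/

theorem iterate_fix_of_finite {X : Type*} {f : X → X} (hf : Function.Injective f) {F : Set X}
    (hF : F.Finite) (hfF : Set.MapsTo f F F) {x : X} (hx : x ∈ F) :
    f^[Nat.card (Equiv.Perm F)] x = x := by
  have : Finite F := hF
  let σ : Equiv.Perm F := Equiv.ofBijective (hfF.restrict f F F)
    (Finite.injective_iff_bijective.1 ((Set.MapsTo.restrict_inj hfF).2 hf.injOn))
  have key : ∀ (n : ℕ) (y : F), ((σ ^ n) y : X) = f^[n] y := by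
    intro n
    induction n with
    | zero => intro y; rfl
    | succ n ih =>
      intro y
      rw [pow_succ, Equiv.Perm.mul_apply, ih, Function.iterate_succ_apply]
      rfl
  rw [← key _ ⟨x, hx⟩, pow_card_eq_one']
  rfl

/-- The subgroup of all elements of `B` whose images are trivial near every point
of `F`. -/
def trivialNear {Γ : Type*} [Group Γ] (ι : Γ →* thompsonV) (B : Subgroup Γ) (F : Set Cantor) :
    Subgroup Γ where
  carrier := {g | g ∈ B ∧ ∀ x ∈ F, (ι g : Cantor ≃ₜ Cantor) x = x ∧ expansion (ι g) x = 0}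
  mul_mem' := by
    rintro f g ⟨hf, hf'⟩ ⟨hg, hg'⟩
    refine ⟨mul_mem hf hg, fun x hx => ?_⟩
    rw [map_mul, coe_mul_apply, expansion_mul, (hg' x hx).1, (hg' x hx).2, (hf' x hx).1,
      (hf' x hx).2]
    exact ⟨rfl, rfl⟩
  one_mem' := ⟨one_mem _, fun x _ => by rw [map_one]; exact ⟨rfl, expansion_one x⟩⟩
  inv_mem' := by
    rintro f ⟨hf, hf'⟩
    refine ⟨inv_mem hf, fun x hx => ?_⟩
    have h := expansion_inv (ι f) x
    rw [(hf' x hx).1, (hf' x hx).2] at h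
    rw [map_inv]
    exact ⟨(coe_inv_apply_eq_iff _).2 (hf' x hx).1.symm, by omega⟩

theorem conj_mem_trivialNear {Γ : Type*} [Group Γ] {ι : Γ →* thompsonV} {B : Subgroup Γ}
    {F : Set Cantor} (hF : ∀ g ∈ B, Set.MapsTo (ι g : Cantor ≃ₜ Cantor) F F) {g n : Γ} (hg : g ∈ B)
    (hn : n ∈ trivialNear ι B F) : g * n * g⁻¹ ∈ trivialNear ι B F := by
  refine ⟨mul_mem (mul_mem hg hn.1) (inv_mem hg), fun x hx => ?_⟩
  have hx' := hF g⁻¹ (inv_mem hg) hx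
  rw [map_inv] at hx'
  obtain ⟨h1, h2⟩ := hn.2 _ hx'
  have h3 := expansion_inv (ι g) (((ι g)⁻¹ : thompsonV).1 x)
  rw [coe_apply_inv_self] at h3
  simp only [map_mul, map_inv, coe_mul_apply, expansion_mul]
  rw [h1, h2, h3, coe_apply_inv_self]
  exact ⟨rfl, by ring⟩

/-- On the stabilizer of a point, expansion is a homomorphism to the integers, so it vanishes on
commutators. -/
theorem commutator_mem_trivialNear {Γ : Type*} [Group Γ] {ι : Γ →* thompsonV} {B : Subgroup Γ}
    {F : Set Cantor} {f g : Γ} (hfB : f ∈ B) (hgB : g ∈ B)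
    (hf : ∀ x ∈ F, (ι f : Cantor ≃ₜ Cantor) x = x) (hg : ∀ x ∈ F, (ι g : Cantor ≃ₜ Cantor) x = x) :
    ⁅f, g⁆ ∈ trivialNear ι B F := by
  rw [commutatorElement_def]
  refine ⟨mul_mem (mul_mem (mul_mem hfB hgB) (inv_mem hfB)) (inv_mem hgB), fun x hx => ?_⟩
  have hf1 := hf x hx
  have hg1 := hg x hx
  have hf2 : ((ι f)⁻¹ : thompsonV).1 x = x := (coe_inv_apply_eq_iff _).2 hf1.symm
  have hg2 : ((ι g)⁻¹ : thompsonV).1 x = x := (coe_inv_apply_eq_iff _).2 hg1.symm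
  have hf3 := expansion_inv (ι f) x
  have hg3 := expansion_inv (ι g) x
  rw [hf1] at hf3
  rw [hg1] at hg3
  simp only [map_mul, map_inv, coe_mul_apply, expansion_mul]
  rw [hg2, hf2, hg1, hf1, hf3, hg3]
  exact ⟨rfl, by ring⟩

/-- The subgroup of all elements of `A` whose images fix the set `Z` pointwise. -/
def pointwiseStab {Γ : Type*} [Group Γ] (ι : Γ →* thompsonV) (A : Subgroup Γ) (Z : Set Cantor) :
    Subgroup Γ where
  carrier := {g | g ∈ A ∧ ∀ x ∈ Z, (ι g : Cantor ≃ₜ Cantor) x = x}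
  mul_mem' := by
    rintro f g ⟨hf, hf'⟩ ⟨hg, hg'⟩
    refine ⟨mul_mem hf hg, fun x hx => ?_⟩
    rw [map_mul, coe_mul_apply, hg' x hx, hf' x hx]
  one_mem' := ⟨one_mem _, fun x _ => by rw [map_one]; rfl⟩
  inv_mem' := by
    rintro f ⟨hf, hf'⟩
    refine ⟨inv_mem hf, fun x hx => ?_⟩
    rw [map_inv]
    exact (coe_inv_apply_eq_iff _).2 (hf' x hx).symm

theorem conj_mem_pointwiseStab {Γ : Type*} [Group Γ] {ι : Γ →* thompsonV} {A : Subgroup Γ}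
    {Z : Set Cantor} (hZ : ∀ g ∈ A, Set.MapsTo (ι g : Cantor ≃ₜ Cantor) Z Z) {g n : Γ} (hg : g ∈ A)
    (hn : n ∈ pointwiseStab ι A Z) : g * n * g⁻¹ ∈ pointwiseStab ι A Z := by
  refine ⟨mul_mem (mul_mem hg hn.1) (inv_mem hg), fun x hx => ?_⟩
  have hx' := hZ g⁻¹ (inv_mem hg) hx
  rw [map_inv] at hx'
  rw [map_mul, map_mul, map_inv, coe_mul_apply, coe_mul_apply, hn.2 _ hx', coe_apply_inv_self]

/-! ### Images of the groups E[a,b] in V -/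

section

variable {E : Subgroup (ℝ ≃ₜ ℝ)}

/-- The order of the permutation group of `F` is an exponent m for which all m-th powers fix `F`
pointwise. A nontrivial commutator of two such powers makes the normal subgroup nontrivial. -/
theorem commutator_rigid_trivialNear (hE : E ≤ homeoPlus) (hlm : LocallyMoving E)
    (hag : HasAbelianGerms E) {ι : E →* thompsonV} {c d : ℝ}
    (hcd : c < d) {F : Set Cantor} (hFfin : F.Finite)
    (hF : ∀ g ∈ rigid E c d, Set.MapsTo (ι g : Cantor ≃ₜ Cantor) F F) :
    ⁅rigid E c d, rigid E c d⁆ ≤ trivialNear ι (rigid E c d) F := by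
  have : Finite F := hFfin
  refine commutator_rigid_le hE hlm hag hcd (fun g hg => hg.1)
    (fun g hg n hn => conj_mem_trivialNear hF hg hn) ?_
  obtain ⟨f, hf, g, hg, hfg⟩ := exists_commutator_pow_ne_one hE hlm hcd
    (m := Nat.card (Equiv.Perm F)) Nat.card_pos
  have hfix : ∀ g ∈ rigid E c d, ∀ x ∈ F,
      (ι (g ^ Nat.card (Equiv.Perm F)) : Cantor ≃ₜ Cantor) x = x := by
    intro g hg x hx
    rw [map_pow, coe_pow_apply]
    exact iterate_fix_of_finite (ι g : Cantor ≃ₜ Cantor).injective hFfin (hF g hg) hx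
  exact ⟨_, commutator_mem_trivialNear (pow_mem hf _) (pow_mem hg _) (hfix f hf) (hfix g hg), hfg⟩

/-- The derived subgroup of `E[a,b]` acts trivially on the support of that of `E[c,d]`. -/
theorem commutator_rigid_apply_eq (hE : E ≤ homeoPlus) (hlm : LocallyMoving E)
    (hag : HasAbelianGerms E) {ι : E →* thompsonV} {a b c d : ℝ}
    (hab : a < b) (hcd : c < d) (hdisj : Set.Ioo a b ∩ Set.Ioo c d = ∅) {f g : E}
    (hf : f ∈ ⁅rigid E a b, rigid E a b⁆) (hg : g ∈ ⁅rigid E c d, rigid E c d⁆) {x : Cantor}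
    (hx : (ι g : Cantor ≃ₜ Cantor) x ≠ x) : (ι f : Cantor ≃ₜ Cantor) x = x := by
  set Z : Set Cantor := {x | ∃ g ∈ ⁅rigid E c d, rigid E c d⁆, (ι g : Cantor ≃ₜ Cantor) x ≠ x}
  have hcomm : ∀ {f g : E}, f ∈ rigid E a b → g ∈ rigid E c d → Commute (ι f) (ι g) :=
    fun hf hg => (rigid_commute hdisj hf hg).map ι
  have hle : ⁅rigid E c d, rigid E c d⁆ ≤ rigid E c d := Subgroup.commutator_le_self _
  have hZ : ∀ f ∈ rigid E a b, Set.MapsTo (ι f : Cantor ≃ₜ Cantor) Z Z := by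
    rintro f hf x ⟨g, hg, hgx⟩
    refine ⟨g, hg, fun h => hgx ?_⟩
    rw [← commute_apply (hcomm hf (hle hg))] at h
    exact (ι f : Cantor ≃ₜ Cantor).injective h
  have htor : ∀ f ∈ rigid E a b, Z ⊆ torsionPart (ι f) := by
    rintro f hf x ⟨g, hg, hgx⟩
    have h := commutator_rigid_trivialNear hE hlm hag hcd (finite_hyperbolicPoints (ι f))
      (fun g hg x hx => commute_mem_hyperbolicPoints (hcomm hf hg) hx) hg
    exact mem_torsionPart_of_commute (hcomm hf (hle hg)) h.2 hgx
  refine (commutator_rigid_le hE hlm hag hab (N := pointwiseStab ι (rigid E a b) Z)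
    (fun g hg => hg.1) (fun g hg n hn => conj_mem_pointwiseStab hZ hg hn) ?_ hf).2 x ⟨g, hg, hx⟩
  -- Any nontrivial `k` works: the power trivial on the torsion part of its image fixes `Z`, and it
  -- is nontrivial because `k` acts on the line without torsion.
  obtain ⟨k, hk, y, -, hky⟩ := exists_rigid_ne hlm hab
  obtain ⟨N, hN, hfix⟩ := exists_pow_fix_torsionPart (ι k)
  refine ⟨k ^ N, ⟨pow_mem hk N, fun x hx => ?_⟩, fun h => pow_apply_ne hE hky hN (by rw [h]; rfl)⟩
  rw [map_pow]
  exact hfix x (htor k hk hx)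

theorem exists_of_mem_groupSupp {ι : E →* thompsonV} {a b : ℝ} {x : Cantor}
    (hx : x ∈ groupSupp (imageRigidDerived ι a b)) :
    ∃ f ∈ ⁅rigid E a b, rigid E a b⁆, (ι f : Cantor ≃ₜ Cantor) x ≠ x := by
  simp only [groupSupp, Set.mem_iUnion] at hx
  obtain ⟨h, hh, hx⟩ := hx
  rw [imageRigidDerived, imageRigid, ← Subgroup.map_commutator] at hh
  obtain ⟨f, hf, rfl⟩ := hh
  exact ⟨f, hf, hx⟩

end

end ThompsonAction

theorem mainTheorem8 (E : Subgroup (ℝ ≃ₜ ℝ)) (hE : E ≤ ThompsonAction.homeoPlus)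
    (hlm : ThompsonAction.LocallyMoving E) (hag : ThompsonAction.HasAbelianGerms E)
    (ι : E →* ThompsonAction.thompsonV) (hι : Function.Injective ι)
    (a b c d : ℝ) (hab : a < b) (hcd : c < d)
    (hdisj : Set.Ioo a b ∩ Set.Ioo c d = ∅) :
    Disjoint (ThompsonAction.groupSupp (ThompsonAction.imageRigidDerived ι a b))
      (ThompsonAction.groupSupp (ThompsonAction.imageRigidDerived ι c d)) := by
  rw [Set.disjoint_left]
  intro x hx hx'
  obtain ⟨f, hf, hfx⟩ := ThompsonAction.exists_of_mem_groupSupp hx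
  obtain ⟨g, hg, hgx⟩ := ThompsonAction.exists_of_mem_groupSupp hx'
  exact hfx (ThompsonAction.commutator_rigid_apply_eq hE hlm hag hab hcd hdisj hf hg hgx)
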